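/- Let $\Bbbk$ be an algebraically closed field and let $X=\operatorname{Spec}\Bbbk[\sigma^\vee\cap M]$ be a normal affine toric variety with a torus-invariant point, where $M$ is a lattice with dual $N$ and $\sigma\subset N\otimes\mathbb{R}$ is a full-dimensional strongly convex rational polyhedral cone. Let $v_\rho\in N$ be the primitive lattice point on the ray $\rho\in\sigma(1)$ and $D_\rho$ the corresponding torus-invariant prime divisor. Assume that $X$ is Gorenstein, i.e. there is $m\in M$ with $\langle m,v_\rho\rangle=1$ for all $\rho$. Let $\mathscr{E}=(E_0,\dots,E_r)$, $r\ge 0$, be pairwise non-isomorphic rank one reflexive sheaves $E_i=\mathcal{O}_X(D_i')$ on $X$. The quiver of sections $Q$ has vertices $0,\dots,r$; its arrows from $i$ to $j$ are the irreducible torus-invariant sections of $\operatorname{Hom}(E_i,E_j)=H^0(\mathcal{O}_X(D_j'-D_i'))$ (up to scalars), i.e. those that are not invertible and are not a product of two non-invertible torus-invariant sections of $\operatorname{Hom}(E_i,E_l)$ and $\operatorname{Hom}(E_l,E_j)$ for any $l$. For an arrow $a$ let $\operatorname{div}(a)\in\mathbb{N}^{\sigma(1)}$ be the divisor of zeros of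 its section, for a path $p$ let $\operatorname{div}(p)$ be the sum of the labels of its arrows (with multiplicity), and let $x^{\operatorname{div}(p)}$ be the corresponding monomial in the Cox ring $\Bbbk[x_\rho:\rho\in\sigma(1)]$. The toric algebra is $A=A_{\mathscr{E}}=\Bbbk Q/J_{\mathscr{E}}$, where $J_{\mathscr{E}}$ is the two-sided ideal generated by all $p^+-p^-$ for paths $p^\pm$ with the same head, tail and label. A cycle $p$ in $Q$ is anticanonical if $x^{\operatorname{div}(p)}=\prod_\rho x_\rho$, and the superpotential $W$ is the formal sum of all anticanonical cycles (cycles are taken up to rotation). For a path $q$, $\partial_qW$ is the sum of all paths $s$ from the head of $q$ to the tail of $q$ such that the cycle "first $q$, then $s$" is a term of $W$. Let $J_W$ be the two-sided ideal of $\Bbbk Q$ generated by all $p^+-p^-$ for which there is a path $q$ such that $\partial_qW=p^++p^-$ is the sum of precisely two paths, and these share neither initial nor final arrow; put $A_W=\Bbbk Q/J_W$. The algebra $A$ is consistent if $A_{\mathscr{E}}$ and $A_W$ are isomorphic $\Bbbk$-algebras. If $A$ is consistent, then for every arrow $a$ of $Q$ the monomial $x^{\operatorname{div}(a)}$ divides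 $\prod_{\rho\in\sigma(1)}x_\rho$. Hence every arrow of $Q$ lies in some anticanonical cycle, i.e. in a term of the superpotential $W$. -/

import Mathlib

open scoped TensorProduct

noncomputable section

namespace ToricSuperpotential

/-! ### Path algebras of quivers -/

section PathAlgebra

open Quiver

/-- A path in a quiver, together with its tail (start) and its head (end).  The trivial paths
`e_i = ⟨i, i, Path.nil⟩` are included. -/
structure QPath (V : Type*) [Quiver V] where
  tail : V
  head : V
  path : Path tail head

/-- The product of two basis elements of the path algebra: `p · q` is "first `q`, then `p`" if
the head of `q` is the tail of `p`, and zero otherwise. -/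
def basisMul (k : Type*) [Field k] {V : Type*} [Quiver V] [DecidableEq V]
    (p q : QPath V) : QPath V →₀ k :=
  if h : q.head = p.tail then
    Finsupp.single ⟨q.tail, p.head, (q.path.cast rfl h).comp p.path⟩ 1
  else 0

/-- The path algebra `kQ`: the vector space with basis the paths of `Q`. -/
def PathAlgebra (k V : Type*) [Field k] [Quiver V] : Type _ := QPath V →₀ k

variable {k V : Type*} [Field k] [Quiver V]

instance : AddCommGroup (PathAlgebra k V) := inferInstanceAs (AddCommGroup (QPath V →₀ k))
instance : Module k (PathAlgebra k V) := inferInstanceAs (Module k (QPath V →₀ k))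

/-- The basis element of `kQ` given by a path. -/
def ofQPath (k : Type*) [Field k] {V : Type*} [Quiver V] (p : QPath V) : PathAlgebra k V :=
  Finsupp.single p (1 : k)

/-- The basis element of `kQ` given by a path from `i` to `j`. -/
def ofPath (k : Type*) [Field k] {V : Type*} [Quiver V] {i j : V} (p : Path i j) :
    PathAlgebra k V :=
  ofQPath k ⟨i, j, p⟩

/-- The bilinear extension of the product of paths. -/
def mulHom (k V : Type*) [Field k] [Quiver V] [DecidableEq V] :
    PathAlgebra k V →ₗ[k] PathAlgebra k V →ₗ[k] PathAlgebra k V :=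
  Finsupp.linearCombination k fun p => Finsupp.linearCombination k fun q => basisMul k p q

theorem pathAlgebra_induction {P : PathAlgebra k V → Prop} (f : PathAlgebra k V)
    (zero : P 0) (add : ∀ f g, P f → P g → P (f + g))
    (smul : ∀ (c : k) p, P (c • ofQPath k p)) : P f := by
  refine Finsupp.induction_linear (motive := P) f zero add fun p c => ?_
  have h : (Finsupp.single p c : QPath V →₀ k) = c • Finsupp.single p 1 := by simp
  rw [h]
  exact smul c p

/-- The unit of the path algebra is the sum of the trivial paths. -/
instance [Fintype V] : One (PathAlgebra k V) := ⟨∑ i : V, ofPath k (Path.nil : Path i i)⟩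

theorem one_def [Fintype V] :
    (1 : PathAlgebra k V) = ∑ i : V, ofPath k (Path.nil : Path i i) := rfl

variable [DecidableEq V]

instance : Mul (PathAlgebra k V) := ⟨fun f g => mulHom k V f g⟩

theorem mul_def (f g : PathAlgebra k V) : f * g = mulHom k V f g := rfl

theorem mulHom_ofQPath (p q : QPath V) :
    mulHom k V (ofQPath k p) (ofQPath k q) = basisMul k p q := by
  unfold mulHom ofQPath
  erw [Finsupp.linearCombination_single, one_smul, Finsupp.linearCombination_single, one_smul]

theorem ofPath_mul_ofPath {i j l : V} (p : Path j l) (q : Path i j) :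
    ofPath k p * ofPath k q = ofPath k (q.comp p) := by
  unfold ofPath
  rw [mul_def, mulHom_ofQPath]
  simp [basisMul]
  rfl

theorem ofPath_mul_ofPath_of_ne {i j j' l : V} (p : Path j' l) (q : Path i j) (h : j ≠ j') :
    ofPath k p * ofPath k q = 0 := by
  unfold ofPath
  rw [mul_def, mulHom_ofQPath]
  simp [basisMul, h]
  rfl

theorem ofQPath_mul_assoc (p q r : QPath V) :
    ofQPath k p * ofQPath k q * ofQPath k r = ofQPath k p * (ofQPath k q * ofQPath k r) := by
  obtain ⟨i, j, p⟩ := p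
  obtain ⟨i', j', q⟩ := q
  obtain ⟨i'', j'', r⟩ := r
  change ofPath k p * ofPath k q * ofPath k r = ofPath k p * (ofPath k q * ofPath k r)
  by_cases h : j' = i
  · subst h
    by_cases h' : j'' = i'
    · subst h'
      simp only [ofPath_mul_ofPath, Path.comp_assoc]
    · rw [ofPath_mul_ofPath, ofPath_mul_ofPath_of_ne _ _ h', ofPath_mul_ofPath_of_ne _ _ h']
      simp [mul_def]
  · by_cases h' : j'' = i'
    · subst h'
      rw [ofPath_mul_ofPath, ofPath_mul_ofPath_of_ne _ _ h, ofPath_mul_ofPath_of_ne _ _ h]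
      simp [mul_def]
    · rw [ofPath_mul_ofPath_of_ne _ _ h, ofPath_mul_ofPath_of_ne _ _ h']
      simp [mul_def]

theorem pathAlgebra_mul_assoc (f g h : PathAlgebra k V) : f * g * h = f * (g * h) := by
  induction f using pathAlgebra_induction with
  | zero => simp [mul_def]
  | add f₁ f₂ h₁ h₂ => simp only [mul_def, map_add, LinearMap.add_apply] at *; rw [h₁, h₂]
  | smul c p =>
    induction g using pathAlgebra_induction with
    | zero => simp [mul_def]
    | add f₁ f₂ h₁ h₂ => simp only [mul_def, map_add, LinearMap.add_apply] at *; rw [h₁, h₂]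
    | smul d q =>
      induction h using pathAlgebra_induction with
      | zero => simp [mul_def]
      | add f₁ f₂ h₁ h₂ => simp only [mul_def, map_add] at *; rw [h₁, h₂]
      | smul e r =>
        have := ofQPath_mul_assoc (k := k) p q r
        simp only [mul_def, map_smul, LinearMap.smul_apply] at *
        rw [this]

variable [Fintype V]

theorem pathAlgebra_one_mul (f : PathAlgebra k V) : 1 * f = f := by
  induction f using pathAlgebra_induction with
  | zero => simp [mul_def]
  | add f₁ f₂ h₁ h₂ => simp only [mul_def, map_add] at *; rw [h₁, h₂]
  | smul c p =>
    obtain ⟨i, j, p⟩ := p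
    change 1 * (c • ofPath k p) = c • ofPath k p
    rw [mul_def, map_smul, one_def, map_sum, LinearMap.sum_apply]
    simp only [← mul_def]
    rw [Finset.sum_eq_single j, ofPath_mul_ofPath, Path.comp_nil]
    · intro l _ hl
      exact ofPath_mul_ofPath_of_ne _ _ hl.symm
    · simp

theorem pathAlgebra_mul_one (f : PathAlgebra k V) : f * 1 = f := by
  induction f using pathAlgebra_induction with
  | zero => simp [mul_def]
  | add f₁ f₂ h₁ h₂ =>
    simp only [mul_def, map_add, LinearMap.add_apply] at *; rw [h₁, h₂]
  | smul c p =>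
    obtain ⟨i, j, p⟩ := p
    change (c • ofPath k p) * 1 = c • ofPath k p
    rw [mul_def, map_smul, LinearMap.smul_apply, one_def, map_sum]
    simp only [← mul_def]
    rw [Finset.sum_eq_single i, ofPath_mul_ofPath, Path.nil_comp]
    · intro l _ hl
      exact ofPath_mul_ofPath_of_ne _ _ hl
    · simp

instance : Ring (PathAlgebra k V) where
  __ := (inferInstance : AddCommGroup (PathAlgebra k V))
  left_distrib f g h := by simp [mul_def]
  right_distrib f g h := by simp [mul_def]
  zero_mul f := by simp [mul_def]
  mul_zero f := by simp [mul_def]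
  mul_assoc := pathAlgebra_mul_assoc
  one_mul := pathAlgebra_one_mul
  mul_one := pathAlgebra_mul_one

instance : Algebra k (PathAlgebra k V) :=
  Algebra.ofModule (fun c f g => by simp [mul_def]) (fun c f g => by simp [mul_def])

end PathAlgebra

/-! ### Cyclic paths and positions of arrows in paths -/

section Paths

open Quiver

/-- Closed paths that differ by a rotation: `r · q` and `q · r`. -/
inductive Rotation (V : Type*) [Quiver V] : (Σ i : V, Path i i) → (Σ i : V, Path i i) → Prop
  | rotate {i j : V} (q : Path i j) (r : Path j i) : Rotation V ⟨i, q.comp r⟩ ⟨j, r.comp q⟩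

/-- Cyclic paths, that is, closed paths up to rotation; these index a basis of
`kQ_cyc = kQ / [kQ, kQ]`. -/
def CyclicPath (V : Type*) [Quiver V] : Type _ := Quot (Rotation V)

/-- The cyclic path of a closed path. -/
def CyclicPath.mk {V : Type*} [Quiver V] {i : V} (p : Path i i) : CyclicPath V :=
  Quot.mk _ ⟨i, p⟩

variable {V : Type*} [Quiver V]

/-- The arrow `a` lies in the support of the path `p`. -/
def Traverses {i j s t : V} (a : i ⟶ j) (p : Path s t) : Prop :=
  ∃ (p₁ : Path s i) (p₂ : Path j t), p = (p₁.cons a).comp p₂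

/-- Two parallel paths have the same initial arrow. -/
def ShareInitialArrow {i j : V} (p q : Path i j) : Prop :=
  ∃ (l : V) (b : i ⟶ l) (p' q' : Path l j), p = b.toPath.comp p' ∧ q = b.toPath.comp q'

/-- Two parallel paths have the same final arrow. -/
def ShareFinalArrow {i j : V} (p q : Path i j) : Prop :=
  ∃ (l : V) (b : l ⟶ j) (p' q' : Path i l), p = p'.cons b ∧ q = q'.cons b

end Paths

/-! ### Affine toric varieties and their rank one reflexive sheaves -/

/-- The real vector space `N ⊗ ℝ`, where `N = Hom(M, ℤ)` is the lattice dual to `M`. -/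
abbrev NReal (M : Type*) [AddCommGroup M] : Type _ := ℝ ⊗[ℤ] Module.Dual ℤ M

/-- The cone in `N ⊗ ℝ` generated by a family of lattice vectors. -/
def latticeCone {M ι : Type*} [AddCommGroup M] (v : ι → Module.Dual ℤ M) :
    PointedCone ℝ (NReal M) :=
  PointedCone.hull ℝ (Set.range fun ρ => (1 : ℝ) ⊗ₜ[ℤ] v ρ)

/-- A normal affine toric variety `X = Spec k[σ^∨ ∩ M]` with a torus-invariant point, given by its
character lattice `M` and its cone `σ ⊂ N ⊗ ℝ`.  The index type `ι` is the set of rays `σ(1)`,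
`v ρ` is the primitive lattice point on the ray `ρ`, and `σ` is the cone generated by the `v ρ`;
it is strongly convex, and it is full-dimensional because `X` has a torus-invariant point. -/
structure AffineToric (M ι : Type*) [AddCommGroup M] where
  v : ι → Module.Dual ℤ M
  v_injective : Function.Injective v
  primitive : ∀ (ρ : ι) (n : ℤ) (w : Module.Dual ℤ M), v ρ = n • w → IsUnit n
  isRay : ∀ ρ : ι, (PointedCone.hull ℝ {(1 : ℝ) ⊗ₜ[ℤ] v ρ}).IsFaceOf (latticeCone v)
  stronglyConvex : (latticeCone v).toConvexCone.Salient
  fullDimensional : Submodule.span ℝ (latticeCone v : Set (NReal M)) = ⊤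

namespace AffineToric

variable {M ι : Type*} [AddCommGroup M] (X : AffineToric M ι)

/-- `X` is Gorenstein: the canonical divisor `-∑ D_ρ` is Cartier, that is, `(1, …, 1)` is in the
image of `M` in the group of torus-invariant Weil divisors. -/
def IsGorenstein : Prop := ∃ m : M, ∀ ρ : ι, X.v ρ m = 1

/-- The divisor of zeros `∑ (⟨m, v_ρ⟩ + D_ρ) D_ρ` of the character `m`, regarded as a rational
section of `O_X(D)`, where `D = ∑ D_ρ D_ρ` is a torus-invariant Weil divisor. -/
def sectionDiv (D : ι → ℤ) (m : M) : ι → ℤ := fun ρ => X.v ρ m + D ρ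

/-- The character `m` is a (torus-invariant) section of `O_X(D)`. -/
def IsSection (D : ι → ℤ) (m : M) : Prop := ∀ ρ : ι, 0 ≤ X.sectionDiv D m ρ

theorem IsSection.add {X : AffineToric M ι} {D D' : ι → ℤ} {m m' : M} (h : X.IsSection D m)
    (h' : X.IsSection D' m') : X.IsSection (D + D') (m + m') := by
  intro ρ
  have h₁ := h ρ
  have h₂ := h' ρ
  simp only [sectionDiv, map_add, Pi.add_apply] at *
  linarith

theorem mul_sections (k : Type*) [Field k] {X : AffineToric M ι} {D D' : ι → ℤ}
    {f g : AddMonoidAlgebra k M} (hf : ∀ m ∈ f.coeff.support, X.IsSection D m)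
    (hg : ∀ m ∈ g.coeff.support, X.IsSection D' m) :
    ∀ m ∈ (f * g).coeff.support, X.IsSection (D + D') m := by
  classical
  intro m hm
  obtain ⟨a, ha, b, hb, rfl⟩ := Finset.mem_add.1 (AddMonoidAlgebra.support_coeff_mul_subset f g hm)
  exact (hf a ha).add (hg b hb)

/-- The coordinate ring `R = k[σ^∨ ∩ M]` of `X`; a character `m` is in `σ^∨` if and only if
`⟨m, v_ρ⟩ ≥ 0` for all rays, that is, if it is a section of `O_X(0)`. -/
def coordinateRing (k : Type*) [Field k] : Subalgebra k (AddMonoidAlgebra k M) where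
  carrier := {f | ∀ m ∈ f.coeff.support, X.IsSection 0 m}
  mul_mem' hf hg := by simpa using mul_sections k hf hg
  add_mem' := by
    classical
    intro f g hf hg m hm
    rcases Finset.mem_union.1 (Finsupp.support_add hm) with h | h
    exacts [hf m h, hg m h]
  algebraMap_mem' c := by
    intro m hm ρ
    have : m = 0 := by
      by_contra h
      exact Finsupp.mem_support_iff.1 hm (by simp [AddMonoidAlgebra.coe_algebraMap, Ne.symm h])
    simp [sectionDiv, this]

/-- The rank one reflexive sheaf `O_X(D)`, as the `R`-module of its sections: the span of the
characters `m` with `⟨m, v_ρ⟩ + D_ρ ≥ 0` for all rays `ρ`.  Every rank one reflexive sheaf on `X`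
is isomorphic to one of this form. -/
def sheaf (k : Type*) [Field k] (D : ι → ℤ) :
    Submodule (X.coordinateRing k) (AddMonoidAlgebra k M) where
  carrier := {f | ∀ m ∈ f.coeff.support, X.IsSection D m}
  zero_mem' := by simp
  add_mem' := by
    classical
    intro f g hf hg m hm
    rcases Finset.mem_union.1 (Finsupp.support_add hm) with h | h
    exacts [hf m h, hg m h]
  smul_mem' := by
    rintro ⟨c, hc⟩ f hf
    rw [← zero_add D]
    exact mul_sections k hc hf

/-! ### The quiver of sections -/

/-- For the sheaves `E_i = O_X(D i)`, the character `m` is an irreducible torus-invariant section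
of `Hom(E_i, E_j) = H⁰(O_X(D j - D i))`: it is not invertible (its divisor is nonzero), and it is
not a product of two noninvertible sections of `Hom(E_i, E_l)` and `Hom(E_l, E_j)` for any `l`. -/
def IsIrreducibleSection {V : Type*} (D : V → ι → ℤ) (i j : V) (m : M) : Prop :=
  X.IsSection (D j - D i) m ∧ X.sectionDiv (D j - D i) m ≠ 0 ∧
    ∀ (l : V) (m' m'' : M), m = m' + m'' →
      X.IsSection (D l - D i) m' → X.IsSection (D j - D l) m'' →
        X.sectionDiv (D l - D i) m' = 0 ∨ X.sectionDiv (D j - D l) m'' = 0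

/-- The vertices of the quiver of sections of the collection `O_X(D 0), …, O_X(D r)`. -/
@[nolint unusedArguments]
def Vertex {r : ℕ} (_X : AffineToric M ι) (_D : Fin (r + 1) → ι → ℤ) : Type := Fin (r + 1)

variable {r : ℕ} {X} {D : Fin (r + 1) → ι → ℤ}

instance : Fintype (Vertex X D) := inferInstanceAs (Fintype (Fin (r + 1)))
instance : DecidableEq (Vertex X D) := inferInstanceAs (DecidableEq (Fin (r + 1)))

/-- The quiver of sections: arrows `i ⟶ j` are the irreducible torus-invariant sections of
`Hom(E_i, E_j)`. -/
instance : Quiver (Vertex X D) where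
  Hom i j := {m : M // X.IsIrreducibleSection D i j m}

/-- The label `div(a) ∈ ℕ^d` of an arrow: the divisor of zeros of its defining section. -/
def arrowDiv {i j : Vertex X D} (a : i ⟶ j) : ι → ℕ :=
  fun ρ => (X.sectionDiv (D j - D i) a.1 ρ).toNat

/-- The label `div(p) ∈ ℕ^d` of a path: the sum of the labels of its arrows. -/
def pathDiv {i j : Vertex X D} (p : Quiver.Path i j) : ι → ℕ :=
  p.addWeight fun a => arrowDiv a

/-- A cycle is anticanonical if its label is the anticanonical divisor `∑ D_ρ`. -/
def IsAnticanonical {i : Vertex X D} (p : Quiver.Path i i) : Prop := pathDiv p = fun _ => 1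

variable (X D)

/-! ### The toric algebra, the superpotential and consistency -/

/-- The ideal `J_E`, generated by the differences of paths with the same tail, head and label. -/
def idealE (k : Type*) [Field k] : TwoSidedIdeal (PathAlgebra k (Vertex X D)) :=
  TwoSidedIdeal.span {x | ∃ (i j : Vertex X D) (p q : Quiver.Path i j),
    pathDiv p = pathDiv q ∧ x = ofPath k p - ofPath k q}

/-- The toric algebra `A_E = kQ / J_E`. -/
abbrev ToricAlgebra (k : Type*) [Field k] : Type _ := (idealE X D k).ringCon.Quotient

open Classical in
/-- The superpotential `W`, the formal sum of all anticanonical cycles; a formal sum of cyclic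
paths is given by its coefficient function. -/
def superpotential (k : Type*) [Field k] : CyclicPath (Vertex X D) → k := fun c =>
  if ∃ (i : Vertex X D) (p : Quiver.Path i i), IsAnticanonical p ∧ CyclicPath.mk p = c
    then 1 else 0

variable {X D}

/-- The partial derivative `∂_q W`, as a formal sum of paths from the head `j` to the tail `i` of
`q`: the coefficient of `∂_q W` at `s` is the coefficient of `W` at the cycle `s · q` (first `q`,
then `s`). -/
def partialW (k : Type*) [Field k] {i j : Vertex X D} (q : Quiver.Path i j) :
    Quiver.Path j i → k :=
  fun s => superpotential X D k (CyclicPath.mk (q.comp s))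

open Classical in
/-- `∂_q W` is the sum `p⁺ + p⁻` of precisely two (distinct) paths. -/
def PartialWEqAdd (k : Type*) [Field k] {i j : Vertex X D} (q : Quiver.Path i j)
    (p₁ p₂ : Quiver.Path j i) : Prop :=
  p₁ ≠ p₂ ∧ partialW k q = Pi.single p₁ 1 + Pi.single p₂ 1

/-- The set `𝒫` of paths `q` such that `∂_q W` is the sum of precisely two paths that share
neither initial nor final arrow. -/
def IsRelationPath (k : Type*) [Field k] {i j : Vertex X D} (q : Quiver.Path i j) : Prop :=
  ∃ p₁ p₂ : Quiver.Path j i, PartialWEqAdd k q p₁ p₂ ∧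
    ¬ ShareInitialArrow p₁ p₂ ∧ ¬ ShareFinalArrow p₁ p₂

variable (X D)

/-- The ideal `J_W` of superpotential relations, generated by the differences `p⁺ - p⁻` such that
`∂_q W = p⁺ + p⁻` for some `q ∈ 𝒫`. -/
def idealW (k : Type*) [Field k] : TwoSidedIdeal (PathAlgebra k (Vertex X D)) :=
  TwoSidedIdeal.span {x | ∃ (i j : Vertex X D) (q : Quiver.Path i j) (p₁ p₂ : Quiver.Path j i),
    IsRelationPath k q ∧ PartialWEqAdd k q p₁ p₂ ∧ x = ofPath k p₁ - ofPath k p₂}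

/-- The superpotential algebra `A_W = kQ / J_W`. -/
abbrev SuperpotentialAlgebra (k : Type*) [Field k] : Type _ := (idealW X D k).ringCon.Quotient

/-- The collection is consistent if `A_E` and `A_W` are isomorphic `k`-algebras. -/
def IsConsistent (k : Type*) [Field k] : Prop :=
  Nonempty (ToricAlgebra X D k ≃ₐ[k] SuperpotentialAlgebra X D k)

end AffineToric

/-- The monomial `x^D = ∏ x_ρ^{D_ρ}` in the Cox ring `k[x_ρ : ρ ∈ σ(1)]`. -/
def coxMonomial (k : Type*) [Field k] {ι : Type*} [Fintype ι] (D : ι → ℕ) : MvPolynomial ι k :=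
  ∏ ρ : ι, MvPolynomial.X ρ ^ D ρ

end ToricSuperpotential

end

/-! Consistency supplies only an abstract algebra isomorphism, so the proof compares an isomorphism
invariant: polynomial identities.

Sending a path from `i` to `j` to the monomial of its label at the place `(j, i)` embeds `A_E` into
matrices of size `r + 1` over a commutative domain. Hence `A_E` satisfies the standard identity of
every degree above `(r + 1)²` (`standardPoly_toricAlgebra_eq_zero`).

Suppose that an arrow `a` lies in no anticanonical cycle. The generators of `J_W` are differences of
subpaths of such cycles, so they avoid `a` and equate paths of equal label. The algebra `A_W` thus
acts through words: `a` opens a new letter, and any other arrow adds its degree to the current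
letter (`idealW_le_ker`). The Gorenstein condition gives a return path from the head of `a` to its
tail and an anticanonical cycle there; attaching the cycle `m` times produces closed paths that
write distinct letters. Their products in different orders are different words, so no standard
identity holds in `A_W` (`exists_standardPoly_superpotentialAlgebra_ne_zero`), a contradiction.

Every arrow therefore lies in an anticanonical cycle, whose label bounds that of the arrow. -/

noncomputable section

namespace ToricSuperpotential

/-! ### The standard polynomial -/

section StandardPolynomial

/-- The standard polynomial `∑ sgn(σ) x_{σ 0} ⋯ x_{σ (n - 1)}`. -/
def standardPoly {R : Type*} [Ring R] {n : ℕ} (x : Fin n → R) : R :=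
  ∑ σ : Equiv.Perm (Fin n), Equiv.Perm.sign σ • (List.ofFn fun i => x (σ i)).prod

theorem map_standardPoly {R S F : Type*} [Ring R] [Ring S] [FunLike F R S] [RingHomClass F R S]
    (f : F) {n : ℕ} (x : Fin n → R) : f (standardPoly x) = standardPoly fun i => f (x i) := by
  simp only [standardPoly, map_sum, Units.smul_def, map_zsmul, map_list_prod, List.map_ofFn]
  rfl

/-- Matrices over a commutative domain satisfy a standard identity. -/
theorem standardPoly_matrix_eq_zero {C V : Type*} [CommRing C] [IsDomain C] [Fintype V]
    [DecidableEq V] {n : ℕ} (hn : Fintype.card V * Fintype.card V < n)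
    (x : Fin n → Matrix V V C) : standardPoly x = 0 := by
  -- The matrices form a free module of rank `|V|²`, which is less than `n`.
  have h : ¬ LinearIndependent C x := fun h => by
    have := h.fintype_card_le_finrank
    rw [Module.finrank_matrix, Module.finrank_self, Fintype.card_fin] at this
    omega
  -- The standard polynomial is the alternatization of the product, and an alternating map vanishes
  -- on linearly dependent families.
  have := (MultilinearMap.alternatization
    (MultilinearMap.mkPiAlgebraFin C n (Matrix V V C))).map_linearDependent x h
  rw [MultilinearMap.alternatization_apply] at this
  exact this

/-- In a monoid algebra the standard polynomial does not vanish at elements of the monoid whose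
products in different orders are different. -/
theorem standardPoly_of_ne_zero {k G : Type*} [Field k] [Monoid G] {n : ℕ} (g : Fin n → G)
    (hg : ∀ σ : Equiv.Perm (Fin n),
      (List.ofFn fun i => g (σ i)).prod = (List.ofFn g).prod → σ = 1) :
    standardPoly (fun i => MonoidAlgebra.of k G (g i)) ≠ 0 := by
  classical
  intro h
  -- Compare coefficients at the product in the given order; by `hg` only `σ = 1` contributes.
  have h' := congrArg (fun f : MonoidAlgebra k G => f.coeff (List.ofFn g).prod) h
  have hprod (σ : Equiv.Perm (Fin n)) :
      (List.ofFn fun i => MonoidAlgebra.of k G (g (σ i))).prod =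
        MonoidAlgebra.single (List.ofFn fun i => g (σ i)).prod 1 := by
    rw [← MonoidAlgebra.of_apply, map_list_prod, List.map_ofFn]
    rfl
  simp only [standardPoly, hprod, Units.smul_def, MonoidAlgebra.coeff_sum, Finsupp.finsetSum_apply,
    MonoidAlgebra.coeff_smul, MonoidAlgebra.coeff_zero, Finsupp.smul_apply,
    MonoidAlgebra.coeff_single, Finsupp.coe_zero, Pi.zero_apply] at h'
  rw [Finset.sum_eq_single 1] at h'
  · simp at h'
  · intro σ _ hσ
    rw [Finsupp.single_eq_of_ne fun h => hσ (hg σ h.symm), smul_zero]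
  · simp

/-- The extra factor on the left-hand side covers the empty list, whose product is the identity
matrix rather than the idempotent at `i`. -/
theorem list_prod_single_mul {R V : Type*} [Ring R] [Fintype V] [DecidableEq V] (i : V)
    (l : List R) :
    (l.map (Matrix.single i i)).prod * Matrix.single i i 1 = Matrix.single i i l.prod := by
  induction l with
  | nil => simp
  | cons x l ih => rw [List.map_cons, List.prod_cons, mul_assoc, ih]; simp

/-- Closed paths at `i` are represented in the corner at `(i, i)`; this reduces their standard
polynomial to one over the coefficient ring. -/
theorem standardPoly_single_mul {R V : Type*} [Ring R] [Fintype V] [DecidableEq V] (i : V)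
    {n : ℕ} (x : Fin n → R) :
    standardPoly (fun m => Matrix.single i i (x m)) * Matrix.single i i 1 =
      Matrix.single i i (standardPoly x) := by
  have h (σ : Equiv.Perm (Fin n)) := list_prod_single_mul i (List.ofFn fun m => x (σ m))
  simp only [List.map_ofFn, Function.comp_def] at h
  simp only [standardPoly, Finset.sum_mul, Units.smul_def, smul_mul_assoc, h]
  change _ = Matrix.singleAddMonoidHom i i _
  simp only [map_sum, map_zsmul, Matrix.singleAddMonoidHom_apply]

end StandardPolynomial

/-! ### Matrix representations of path algebras -/

section Weight

open Quiver

variable {V G : Type*} [Quiver V] [Monoid G]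

/-- The weight of a path in a monoid, where the arrows are multiplied from right to left. -/
def pathWeight (w : ∀ {i j : V}, (i ⟶ j) → G) : ∀ {i j : V}, Path i j → G
  | _, _, Path.nil => 1
  | _, _, Path.cons p b => w b * pathWeight w p

theorem pathWeight_comp (w : ∀ {i j : V}, (i ⟶ j) → G) {i j l : V} (p : Path i j) (q : Path j l) :
    pathWeight w (p.comp q) = pathWeight w q * pathWeight w p := by
  induction q with
  | nil => simp [pathWeight]
  | cons q b ih => simp [pathWeight, ih, mul_assoc]

variable (k : Type*) [Field k] [Fintype V] [DecidableEq V]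

/-- The linear map underlying `weightHom`. -/
def weightLinearMap (w : ∀ {i j : V}, (i ⟶ j) → G) :
    PathAlgebra k V →ₗ[k] Matrix V V (MonoidAlgebra k G) :=
  Finsupp.linearCombination k fun p : QPath V =>
    Matrix.single p.head p.tail (MonoidAlgebra.of k G (pathWeight w p.path))

theorem weightLinearMap_ofPath (w : ∀ {i j : V}, (i ⟶ j) → G) {i j : V} (p : Path i j) :
    weightLinearMap k w (ofPath k p) =
      Matrix.single j i (MonoidAlgebra.of k G (pathWeight w p)) := by
  unfold weightLinearMap ofPath ofQPath
  erw [Finsupp.linearCombination_single, one_smul]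

theorem weightLinearMap_mul (w : ∀ {i j : V}, (i ⟶ j) → G) (f g : PathAlgebra k V) :
    weightLinearMap k w (f * g) = weightLinearMap k w f * weightLinearMap k w g := by
  induction f using pathAlgebra_induction with
  | zero => simp
  | add f₁ f₂ h₁ h₂ => rw [add_mul, map_add, h₁, h₂, map_add, add_mul]
  | smul c p =>
    induction g using pathAlgebra_induction with
    | zero => simp
    | add f₁ f₂ h₁ h₂ => rw [mul_add, map_add, h₁, h₂, map_add, mul_add]
    | smul d q =>
      obtain ⟨i, j, p⟩ := p
      obtain ⟨i', j', q⟩ := q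
      change weightLinearMap k w (c • ofPath k p * d • ofPath k q) =
        weightLinearMap k w (c • ofPath k p) * weightLinearMap k w (d • ofPath k q)
      suffices weightLinearMap k w (ofPath k p * ofPath k q) =
          weightLinearMap k w (ofPath k p) * weightLinearMap k w (ofPath k q) by
        rw [smul_mul_assoc, mul_smul_comm, map_smul, map_smul, this, map_smul, map_smul,
          smul_mul_assoc, mul_smul_comm]
      by_cases h : j' = i
      · subst h
        rw [ofPath_mul_ofPath]
        simp only [weightLinearMap_ofPath, pathWeight_comp, map_mul, Matrix.single_mul_single_same]
      · rw [ofPath_mul_ofPath_of_ne _ _ h, map_zero, weightLinearMap_ofPath,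
          weightLinearMap_ofPath, Matrix.single_mul_single_of_ne _ _ _ _ (Ne.symm h)]

/-- The representation of the path algebra by matrices over a monoid algebra which maps a path
from `i` to `j` to its weight at the place `(j, i)`. -/
def weightHom (w : ∀ {i j : V}, (i ⟶ j) → G) :
    PathAlgebra k V →+* Matrix V V (MonoidAlgebra k G) where
  toFun := weightLinearMap k w
  map_zero' := map_zero _
  map_add' := map_add _
  map_one' := by
    simp only [one_def, map_sum, weightLinearMap_ofPath, pathWeight, map_one]
    exact Matrix.sum_single_one
  map_mul' := weightLinearMap_mul k w

theorem weightHom_apply (w : ∀ {i j : V}, (i ⟶ j) → G) (f : PathAlgebra k V) :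
    weightHom k w f = weightLinearMap k w f := rfl

theorem weightHom_ofPath (w : ∀ {i j : V}, (i ⟶ j) → G) {i j : V} (p : Path i j) :
    weightHom k w (ofPath k p) = Matrix.single j i (MonoidAlgebra.of k G (pathWeight w p)) :=
  weightLinearMap_ofPath k w p

/-- The kernel of `weightHom` is generated by differences of parallel paths of the same weight. -/
theorem mem_of_weightHom_eq_zero (w : ∀ {i j : V}, (i ⟶ j) → G)
    (I : TwoSidedIdeal (PathAlgebra k V))
    (hI : ∀ (i j : V) (p q : Path i j), pathWeight w p = pathWeight w q →
      ofPath k p - ofPath k q ∈ I)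
    {f : PathAlgebra k V} (hf : weightHom k w f = 0) : f ∈ I := by
  classical
  -- One path is chosen for each realized weight, and `s` extends the choice linearly. Modulo `I`
  -- each path equals its representative, so `s` recovers `f` from its image.
  let rep (i j : V) (g : G) : PathAlgebra k V :=
    if h : ∃ p : Path i j, pathWeight w p = g then ofPath k h.choose else 0
  let s : Matrix V V (MonoidAlgebra k G) →ₗ[k] PathAlgebra k V :=
    { toFun := fun A => ∑ j, ∑ i, Finsupp.linearCombination k (rep i j) (A j i).coeff
      map_add' := fun A B => by
        simp only [Matrix.add_apply, MonoidAlgebra.coeff_add, map_add, Finset.sum_add_distrib]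
      map_smul' := fun c A => by
        simp only [Matrix.smul_apply, MonoidAlgebra.coeff_smul, map_smul, Finset.smul_sum,
          RingHom.id_apply] }
  have hs {i j : V} (p : Path i j) :
      s (weightHom k w (ofPath k p)) = rep i j (pathWeight w p) := by
    rw [weightHom_ofPath]
    change ∑ j', ∑ i', Finsupp.linearCombination k (rep i' j') _ = _
    rw [Finset.sum_eq_single j, Finset.sum_eq_single i]
    · simp [MonoidAlgebra.of_apply, Finsupp.linearCombination_single]
    · intro i' _ hi
      rw [Matrix.single_apply_of_col_ne _ _ hi.symm]
      simp
    · simp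
    · intro j' _ hj
      refine Finset.sum_eq_zero fun i' _ => ?_
      rw [Matrix.single_apply_of_row_ne hj.symm]
      simp
    · simp
  have key : f - s (weightHom k w f) ∈ I := by
    clear hf
    induction f using pathAlgebra_induction with
    | zero => simp
    | add f₁ f₂ h₁ h₂ =>
      rw [map_add, map_add, add_sub_add_comm]
      exact I.add_mem h₁ h₂
    | smul c p =>
      obtain ⟨i, j, p⟩ := p
      change c • ofPath k p - s (weightHom k w (c • ofPath k p)) ∈ I
      have h : ofPath k p - s (weightHom k w (ofPath k p)) ∈ I := by
        have hp : ∃ q : Path i j, pathWeight w q = pathWeight w p := ⟨p, rfl⟩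
        rw [hs, show rep i j (pathWeight w p) = ofPath k hp.choose from dif_pos hp]
        exact hI i j _ _ hp.choose_spec.symm
      rw [weightHom_apply, map_smul, map_smul, ← smul_sub, ← weightHom_apply, Algebra.smul_def]
      exact I.mul_mem_left _ _ h
  simpa [hf] using key

theorem standardPoly_mem_of_quotient {R : Type*} [Ring R] (I : TwoSidedIdeal R) {n : ℕ}
    (x : Fin n → R) : standardPoly (fun m => I.ringCon.mk' (x m)) = 0 ↔ standardPoly x ∈ I := by
  rw [← map_standardPoly, ← TwoSidedIdeal.mem_ker, TwoSidedIdeal.ker_ringCon_mk']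

end Weight

/-! ### Words that record the positions of an arrow -/

section Words

open Quiver

/-- The list with the new head `0`. -/
def newEntry : Function.End (List ℕ) := List.cons 0

/-- Addition of `n` to the head of a list. -/
def addToHead (n : ℕ) : Function.End (List ℕ) := List.modifyHead (n + ·)

theorem addToHead_add (m n : ℕ) : addToHead (m + n) = addToHead m * addToHead n := by
  funext l
  change _ = addToHead m (addToHead n l)
  cases l <;> simp [addToHead, add_assoc]

theorem addToHead_zero : addToHead 0 = 1 := by
  funext l
  change _ = l
  cases l <;> simp [addToHead]

/-- Evaluation at the empty list recovers the sequence of letters, so products in different orders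
can be told apart. -/
theorem list_prod_end_apply {α : Type*} (f : ℕ → α) (l : List ℕ)
    (g : ℕ → Function.End (List α)) (hg : ∀ m l', g m l' = f m :: l') :
    (l.map g).prod [] = l.map f := by
  induction l with
  | nil => rfl
  | cons m l ih =>
    rw [List.map_cons, List.prod_cons]
    change g m ((l.map g).prod []) = _
    rw [ih, hg, List.map_cons]

variable {V : Type*} [Quiver V]

theorem Traverses.comp_left {i j s t u : V} {a : i ⟶ j} {p : Path t u} (h : Traverses a p)
    (q : Path s t) : Traverses a (q.comp p) := by
  obtain ⟨p₁, p₂, rfl⟩ := h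
  exact ⟨q.comp p₁, p₂, by simp [← Path.comp_assoc]⟩

theorem Traverses.cons {i j s t u : V} {a : i ⟶ j} {p : Path s t} (h : Traverses a p)
    (b : t ⟶ u) : Traverses a (p.cons b) := by
  obtain ⟨p₁, p₂, rfl⟩ := h
  exact ⟨p₁, p₂.cons b, by simp⟩

theorem not_traverses_nil {i j s : V} (a : i ⟶ j) : ¬ Traverses a (Path.nil : Path s s) := by
  rintro ⟨p₁, p₂, h⟩
  have := congrArg Path.length h
  simp only [Path.length_nil, Path.length_comp, Path.length_cons] at this
  omega

theorem traverses_cons_self {i j s : V} (a : i ⟶ j) (p : Path s i) : Traverses a (p.cons a) :=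
  ⟨p, Path.nil, rfl⟩

open Classical in
/-- The weight in the monoid of maps `List ℕ → List ℕ` where the arrow `a` starts a new entry and
any other arrow `b` adds `d b` to the first entry. -/
def wordWeight (d : ∀ {s t : V}, (s ⟶ t) → ℕ) {i j : V} (a : i ⟶ j) {s t : V} (b : s ⟶ t) :
    Function.End (List ℕ) :=
  if (⟨s, t, b⟩ : Σ s t : V, s ⟶ t) = ⟨i, j, a⟩ then newEntry else addToHead (d b)

theorem wordWeight_self (d : ∀ {s t : V}, (s ⟶ t) → ℕ) {i j : V} (a : i ⟶ j) :
    wordWeight d a a = newEntry := if_pos rfl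

/-- The weight of a path that does not traverse `a`. -/
theorem pathWeight_wordWeight (d : ∀ {s t : V}, (s ⟶ t) → ℕ) {i j : V} (a : i ⟶ j) {s t : V}
    (p : Path s t) (hp : ¬ Traverses a p) :
    pathWeight (wordWeight d a) p = addToHead (p.addWeight d) := by
  induction p with
  | nil => simp [pathWeight, addToHead_zero]
  | @cons t u p b ih =>
    have hb : (⟨t, u, b⟩ : Σ s t : V, s ⟶ t) ≠ ⟨i, j, a⟩ := by
      intro h
      obtain ⟨rfl, h⟩ := Sigma.mk.inj_iff.1 h
      obtain ⟨rfl, h⟩ := Sigma.mk.inj_iff.1 (eq_of_heq h)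
      obtain rfl := eq_of_heq h
      exact hp (traverses_cons_self b p)
    rw [pathWeight, ih fun h => hp (h.cons b), wordWeight, if_neg hb, Path.addWeight_cons,
      ← addToHead_add, add_comm]

/-- A vertex that can be reached can be reached without traversing an arrow that starts in it. -/
theorem exists_not_traverses {i j s : V} (a : i ⟶ j) (p : Path s i) :
    ∃ q : Path s i, ¬ Traverses a q := by
  -- The induction runs along `p`, whose intermediate vertices differ from `i`; the second
  -- alternative records that `i` has already been reached.
  suffices H : ∀ {t : V} (p : Path s t),
      (∃ q : Path s t, ¬ Traverses a q) ∨ ∃ q : Path s i, ¬ Traverses a q by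
    exact (H p).elim id id
  intro t p
  induction p with
  | nil => exact Or.inl ⟨Path.nil, not_traverses_nil a⟩
  | @cons t u p b ih =>
    rcases ih with ⟨q, hq⟩ | h
    · by_cases hb : Traverses a (q.cons b)
      · right
        -- Since `q` avoids `a`, the arrow `a` can only be the last one, and then `q` itself already
        -- ends in `i`.
        obtain ⟨p₁, p₂, h⟩ := hb
        cases p₂ with
        | nil =>
          simp only [Path.comp_nil, Path.cons.injEq] at h
          obtain ⟨rfl, -, -⟩ := h
          exact ⟨q, hq⟩
        | cons p₂ b' =>
          simp only [Path.comp_cons, Path.cons.injEq] at h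
          obtain ⟨rfl, h, -⟩ := h
          exact absurd ⟨p₁, p₂, eq_of_heq h⟩ hq
      · exact Or.inl ⟨_, hb⟩
    · exact Or.inr h

end Words

namespace AffineToric

open Quiver

variable {M ι : Type*} [AddCommGroup M] {X : AffineToric M ι} {r : ℕ} {D : Fin (r + 1) → ι → ℤ}

/-! ### Paths with a given label -/

/-- If `O_X(D' - D)` has a nowhere vanishing section, then `O_X(D)` and `O_X(D')` are
isomorphic. -/
theorem nonempty_sheaf_equiv (k : Type*) [Field k] {D D' : ι → ℤ} {m : M}
    (h : X.sectionDiv (D' - D) m = 0) :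
    Nonempty (X.sheaf k D ≃ₗ[X.coordinateRing k] X.sheaf k D') := by
  classical
  have mul_mem {E E' : ι → ℤ} {n : M} (hn : X.sectionDiv (E' - E) n = 0)
      {f : AddMonoidAlgebra k M} (hf : f ∈ X.sheaf k E) :
      AddMonoidAlgebra.single n 1 * f ∈ X.sheaf k E' := by
    have hs : ∀ l ∈ (AddMonoidAlgebra.single n (1 : k)).coeff.support,
        X.IsSection (E' - E) l := by
      intro l hl ρ
      obtain rfl : l = n := by
        by_contra hne
        exact Finsupp.mem_support_iff.1 hl (by simp [Ne.symm hne])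
      rw [hn]
      exact le_rfl
    intro l hl
    have := mul_sections k hs hf l hl
    rwa [sub_add_cancel] at this
  have h' : X.sectionDiv (D - D') (-m) = 0 := by
    funext ρ
    have := congrFun h ρ
    simp only [sectionDiv, Pi.sub_apply, Pi.zero_apply, map_neg] at *
    linarith
  have hinv (f : AddMonoidAlgebra k M) :
      AddMonoidAlgebra.single (-m) 1 * (AddMonoidAlgebra.single m 1 * f) = f := by
    rw [← mul_assoc, AddMonoidAlgebra.single_mul_single, neg_add_cancel, mul_one,
      ← AddMonoidAlgebra.one_def, one_mul]
  have hinv' (f : AddMonoidAlgebra k M) :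
      AddMonoidAlgebra.single m 1 * (AddMonoidAlgebra.single (-m) 1 * f) = f := by
    rw [← mul_assoc, AddMonoidAlgebra.single_mul_single, add_neg_cancel, mul_one,
      ← AddMonoidAlgebra.one_def, one_mul]
  exact ⟨{
    toFun := fun f => ⟨AddMonoidAlgebra.single m 1 * f.1, mul_mem h f.2⟩
    invFun := fun f => ⟨AddMonoidAlgebra.single (-m) 1 * f.1, mul_mem h' f.2⟩
    map_add' := fun f g => Subtype.ext (mul_add _ _ _)
    map_smul' := fun c f => Subtype.ext (mul_left_comm _ _ _)
    left_inv := fun f => Subtype.ext (hinv f.1)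
    right_inv := fun f => Subtype.ext (hinv' f.1) }⟩

theorem pathDiv_comp {i j l : Vertex X D} (p : Path i j) (q : Path j l) :
    pathDiv (p.comp q) = pathDiv p + pathDiv q :=
  Path.addWeight_comp _ p q

theorem arrowDiv_le_pathDiv {i j s t : Vertex X D} {a : i ⟶ j} {p : Path s t}
    (h : Traverses a p) : arrowDiv a ≤ pathDiv p := by
  obtain ⟨p₁, p₂, rfl⟩ := h
  rw [pathDiv_comp, pathDiv, Path.addWeight_cons]
  exact le_add_right le_add_self

/-- Every torus-invariant section is a product of irreducible ones. -/
theorem exists_path_pathDiv [Fintype ι] (k : Type*) [Field k]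
    (distinct : ∀ i j : Fin (r + 1), i ≠ j →
      IsEmpty (X.sheaf k (D i) ≃ₗ[X.coordinateRing k] X.sheaf k (D j)))
    (i j : Vertex X D) (m : M) (hm : X.IsSection (D j - D i) m) :
    ∃ p : Path i j, ∀ ρ, (pathDiv p ρ : ℤ) = X.sectionDiv (D j - D i) m ρ := by
  -- Induction on the degree of the divisor: a nonzero effective divisor has positive degree, so
  -- both factors of a reducible section have smaller degree.
  induction hN : (∑ ρ, X.sectionDiv (D j - D i) m ρ).toNat using Nat.strong_induction_on
    generalizing i j m with
  | _ N ih =>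
  have sum_pos {E : ι → ℤ} {n : M} (hn : X.IsSection E n) (hne : X.sectionDiv E n ≠ 0) :
      0 < ∑ ρ, X.sectionDiv E n ρ := by
    obtain ⟨ρ, hρ⟩ := Function.ne_iff.1 hne
    exact Finset.sum_pos' (fun ρ _ => hn ρ) ⟨ρ, Finset.mem_univ _, lt_of_le_of_ne (hn ρ) hρ.symm⟩
  by_cases h0 : X.sectionDiv (D j - D i) m = 0
  -- An invertible section would identify two sheaves of the collection.
  · obtain rfl : i = j := by
      by_contra hij
      exact (distinct i j hij).elim (nonempty_sheaf_equiv k h0).some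
    exact ⟨Path.nil, fun ρ => by rw [h0]; simp [pathDiv]⟩
  by_cases hirr : X.IsIrreducibleSection D i j m
  · let a : i ⟶ j := ⟨m, hirr⟩
    refine ⟨a.toPath, fun ρ => ?_⟩
    simp only [Hom.toPath, pathDiv, Path.addWeight_cons, Path.addWeight_nil, zero_add]
    exact Int.toNat_of_nonneg (hm ρ)
  · simp only [IsIrreducibleSection, not_and, not_forall, not_or] at hirr
    obtain ⟨l, m', m'', rfl, hm', hm'', h', h''⟩ := hirr hm h0
    have hadd (ρ : ι) : X.sectionDiv (D j - D i) (m' + m'') ρ =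
        X.sectionDiv (D l - D i) m' ρ + X.sectionDiv (D j - D l) m'' ρ := by
      simp only [sectionDiv, Pi.sub_apply, map_add]
      ring
    have hsum : ∑ ρ, X.sectionDiv (D j - D i) (m' + m'') ρ =
        ∑ ρ, X.sectionDiv (D l - D i) m' ρ + ∑ ρ, X.sectionDiv (D j - D l) m'' ρ := by
      rw [← Finset.sum_add_distrib]
      exact Finset.sum_congr rfl fun ρ _ => hadd ρ
    have pos' := sum_pos hm' h'
    have pos'' := sum_pos hm'' h''
    obtain ⟨p, hp⟩ := ih _ (by omega) i l m' hm' rfl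
    obtain ⟨q, hq⟩ := ih _ (by omega) l j m'' hm'' rfl
    refine ⟨Path.comp (V := Vertex X D) (b := l) p q, fun ρ => ?_⟩
    rw [hadd, ← hp, ← hq, ← Nat.cast_add]
    exact congrArg Nat.cast (congrFun (pathDiv_comp (X := X) (D := D) (j := l) p q) ρ)

/-- The Gorenstein character is an endomorphism of every `E_i` with divisor `∑ D_ρ`; a factorization
into irreducible sections is the cycle. -/
theorem exists_isAnticanonical [Fintype ι] (hX : X.IsGorenstein) (k : Type*) [Field k]
    (distinct : ∀ i j : Fin (r + 1), i ≠ j →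
      IsEmpty (X.sheaf k (D i) ≃ₗ[X.coordinateRing k] X.sheaf k (D j)))
    (i : Vertex X D) : ∃ p : Path i i, IsAnticanonical p := by
  obtain ⟨m, hm⟩ := hX
  have h (ρ : ι) : X.sectionDiv (D i - D i) m ρ = 1 := by simp [sectionDiv, hm]
  obtain ⟨p, hp⟩ := exists_path_pathDiv k distinct i i m fun ρ => by rw [h]; exact zero_le_one
  exact ⟨p, funext fun ρ => by exact_mod_cast (hp ρ).trans (h ρ)⟩

/-- The quiver of sections is strongly connected. -/
theorem nonempty_path [Fintype ι] (hX : X.IsGorenstein) (k : Type*) [Field k]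
    (distinct : ∀ i j : Fin (r + 1), i ≠ j →
      IsEmpty (X.sheaf k (D i) ≃ₗ[X.coordinateRing k] X.sheaf k (D j)))
    (i j : Vertex X D) : Nonempty (Path i j) := by
  obtain ⟨m, hm⟩ := hX
  -- A large multiple of the Gorenstein character compensates all negative coefficients of `D j - D
  -- i`; the sum of absolute values bounds each of them.
  obtain ⟨p, -⟩ := exists_path_pathDiv k distinct i j
    ((∑ ρ, |(D j - D i) ρ|) • m) fun ρ => by
      have h₁ := Finset.single_le_sum (f := fun ρ => |(D j - D i) ρ|)
        (fun ρ _ => abs_nonneg _) (Finset.mem_univ ρ)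
      have h₂ := neg_abs_le ((D j - D i) ρ)
      simp only [sectionDiv, map_smul, hm, smul_eq_mul, mul_one]
      linarith
  exact ⟨p⟩

/-! ### Anticanonical cycles -/

/-- The label of a cyclic path. -/
def cyclicDiv : CyclicPath (Vertex X D) → ι → ℕ :=
  Quot.lift (fun c => pathDiv c.2) (by
    rintro _ _ ⟨q, s⟩
    rw [pathDiv_comp, pathDiv_comp, add_comm])

/-- Labels are invariant under rotation, so being anticanonical does not depend on the
representative of the cyclic path. -/
theorem superpotential_mk_ne_zero_iff (k : Type*) [Field k] {i : Vertex X D} (p : Path i i) :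
    superpotential X D k (CyclicPath.mk p) ≠ 0 ↔ IsAnticanonical p := by
  unfold superpotential
  split_ifs with h
  · obtain ⟨j, q, hq, h⟩ := h
    have : pathDiv q = pathDiv p := congrArg cyclicDiv h
    simpa [IsAnticanonical, ← this] using hq
  · simpa using fun hp => h ⟨i, p, hp, rfl⟩

theorem PartialWEqAdd.isAnticanonical {k : Type*} [Field k] {i j : Vertex X D} {q : Path i j}
    {p₁ p₂ : Path j i} (h : PartialWEqAdd k q p₁ p₂) :
    IsAnticanonical (q.comp p₁) ∧ IsAnticanonical (q.comp p₂) := by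
  classical
  simp only [← superpotential_mk_ne_zero_iff k]
  obtain ⟨hne, h⟩ := h
  -- As `p₁ ≠ p₂`, both coefficients are `1`, in every characteristic.
  have h₁ := congrFun h p₁
  have h₂ := congrFun h p₂
  simp only [partialW, Pi.add_apply, Pi.single_apply, if_true, if_neg hne, if_neg hne.symm,
    add_zero, zero_add] at h₁ h₂
  exact ⟨h₁ ▸ one_ne_zero, h₂ ▸ one_ne_zero⟩

/-! ### The toric algebra satisfies a polynomial identity, and the superpotential algebra does
not if an arrow is missing in the superpotential -/

theorem pathWeight_arrowDiv {i j : Vertex X D} (p : Path i j) :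
    pathWeight (G := Multiplicative (ι → ℕ)) (fun b => Multiplicative.ofAdd (arrowDiv b)) p =
      Multiplicative.ofAdd (pathDiv p) := by
  induction p with
  | nil => simp [pathWeight, pathDiv]
  | cons p b ih =>
    rw [pathWeight, ih, mul_comm, ← ofAdd_add]
    simp [pathDiv]

/-- The label representation of `kQ` has its kernel inside `J_E`, and its target is a matrix ring
over the domain `k[ℕ^ι]`. -/
theorem standardPoly_toricAlgebra_eq_zero (k : Type*) [Field k] {n : ℕ}
    (hn : (r + 1) * (r + 1) < n) (x : Fin n → ToricAlgebra X D k) : standardPoly x = 0 := by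
  have hsurj : ∀ y : ToricAlgebra X D k, ∃ z, (idealE X D k).ringCon.mk' z = y := fun y =>
    Quotient.inductionOn' y fun z => ⟨z, rfl⟩
  choose z hz using fun m => hsurj (x m)
  obtain rfl : (fun m => (idealE X D k).ringCon.mk' (z m)) = x := funext hz
  rw [standardPoly_mem_of_quotient]
  refine mem_of_weightHom_eq_zero k
    (fun b => Multiplicative.ofAdd (arrowDiv b) : ∀ {i j : Vertex X D}, (i ⟶ j) →
      Multiplicative (ι → ℕ)) _ (fun i j p q h => ?_) ?_
  · rw [pathWeight_arrowDiv, pathWeight_arrowDiv] at h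
    exact TwoSidedIdeal.subset_span ⟨i, j, p, q, Multiplicative.ofAdd.injective h, rfl⟩
  · rw [map_standardPoly]
    refine standardPoly_matrix_eq_zero ?_ _
    rwa [show Fintype.card (Vertex X D) = r + 1 from Fintype.card_fin _]

/-! ### Failure of the standard identities when an arrow is missing from the superpotential -/

variable [Fintype ι]

/-- The degree of an arrow of the quiver of sections. -/
def arrowDegree {i j : Vertex X D} (a : i ⟶ j) : ℕ := ∑ ρ, arrowDiv a ρ

theorem addWeight_arrowDegree {i j : Vertex X D} (p : Path i j) :
    p.addWeight (fun a => arrowDegree a) = ∑ ρ, pathDiv p ρ := by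
  induction p with
  | nil => simp [pathDiv]
  | cons p b ih =>
    simp only [pathDiv, Path.addWeight_cons, Pi.add_apply, Finset.sum_add_distrib] at *
    rw [ih]
    rfl

/-- Both sides of a relation complete the same path `q` to an anticanonical cycle. Hence they avoid
`a`, have equal labels, and act by adding the same degree to the first entry. -/
theorem idealW_le_ker {k : Type*} [Field k] {i j : Vertex X D} (a : i ⟶ j)
    (ha : ∀ (l : Vertex X D) (p : Path l l), IsAnticanonical p → ¬ Traverses a p) :
    idealW X D k ≤
      TwoSidedIdeal.ker (weightHom k (wordWeight (fun b => arrowDegree b) a)) := by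
  refine TwoSidedIdeal.span_le.2 ?_
  rintro _ ⟨s, t, q, p₁, p₂, -, h, rfl⟩
  have h' := h.isAnticanonical
  rw [SetLike.mem_coe, TwoSidedIdeal.mem_ker, map_sub, weightHom_ofPath, weightHom_ofPath,
    pathWeight_wordWeight _ a p₁ fun hp => ha _ _ h'.1 (hp.comp_left q),
    pathWeight_wordWeight _ a p₂ fun hp => ha _ _ h'.2 (hp.comp_left q),
    addWeight_arrowDegree, addWeight_arrowDegree]
  have : pathDiv p₁ = pathDiv p₂ := by
    have := h'.1.trans h'.2.symm
    rwa [pathDiv_comp, pathDiv_comp, add_right_inj] at this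
  rw [this, sub_self]

/-- The witnesses are the closed paths "first `a`, then `s` back to `i`, then `m` times the
anticanonical cycle `p`". Such a path prepends the letter `m * |ι| + c`, where `c` is the degree of
`s`. -/
theorem exists_standardPoly_superpotentialAlgebra_ne_zero (hX : X.IsGorenstein) {k : Type*}
    [Field k] (distinct : ∀ i j : Fin (r + 1), i ≠ j →
      IsEmpty (X.sheaf k (D i) ≃ₗ[X.coordinateRing k] X.sheaf k (D j)))
    {i j : Vertex X D} (a : i ⟶ j)
    (ha : ∀ (l : Vertex X D) (p : Path l l), IsAnticanonical p → ¬ Traverses a p) (n : ℕ) :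
    ∃ x : Fin n → SuperpotentialAlgebra X D k, standardPoly x ≠ 0 := by
  -- The label of `a` is nonzero, so there is a ray; hence the letters for different `m` differ.
  have hι : 0 < Fintype.card ι := by
    rw [Fintype.card_pos_iff]
    obtain ⟨ρ, -⟩ := Function.ne_iff.1 a.2.2.1
    exact ⟨ρ⟩
  obtain ⟨p, hp⟩ := exists_isAnticanonical hX k distinct i
  obtain ⟨s, hs⟩ := exists_not_traverses a (nonempty_path hX k distinct j i).some
  let w : ∀ {s t : Vertex X D}, (s ⟶ t) → Function.End (List ℕ) :=
    wordWeight (fun b => arrowDegree b) a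
  have hwp : pathWeight w p = addToHead (Fintype.card ι) := by
    rw [pathWeight_wordWeight _ a p (ha _ _ hp), addWeight_arrowDegree,
      show pathDiv p = fun _ => 1 from hp]
    simp
  let c : ℕ := ∑ ρ, pathDiv s ρ
  have hws : pathWeight w s = addToHead c := by
    rw [pathWeight_wordWeight _ a s hs, addWeight_arrowDegree]
  have hpath (m : ℕ) : ∃ q : Path i i, ∀ l, pathWeight w q l = (m * Fintype.card ι + c) :: l := by
    induction m with
    | zero =>
      refine ⟨a.toPath.comp s, fun l => ?_⟩
      rw [pathWeight_comp, hws, Hom.toPath, pathWeight, pathWeight, mul_one,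
        show w a = newEntry from wordWeight_self _ a]
      change addToHead c (newEntry l) = _
      simp [addToHead, newEntry]
    | succ m ih =>
      obtain ⟨q, hq⟩ := ih
      refine ⟨q.comp p, fun l => ?_⟩
      rw [pathWeight_comp, hwp]
      change addToHead _ (pathWeight w q l) = _
      rw [hq, add_mul, one_mul, add_right_comm, add_comm _ (Fintype.card ι)]
      rfl
  choose q hq using hpath
  refine ⟨fun m => (idealW X D k).ringCon.mk' (ofPath k (q m)), fun h => ?_⟩
  rw [standardPoly_mem_of_quotient] at h
  have h := (TwoSidedIdeal.mem_ker _).1 (idealW_le_ker a ha h)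
  rw [map_standardPoly] at h
  simp only [weightHom_ofPath] at h
  -- The vanishing matrix identity is read off at the entry `(i, i)`.
  have h' := standardPoly_single_mul i
    (fun m : Fin n => MonoidAlgebra.of k (Function.End (List ℕ)) (pathWeight w (q m)))
  rw [h, zero_mul] at h'
  have h'' := congrFun (congrFun h' i) i
  rw [Matrix.single_apply_same] at h''
  refine standardPoly_of_ne_zero (k := k) (fun m : Fin n => pathWeight w (q m)) (fun σ hσ => ?_)
    h''.symm
  have happ (τ : Equiv.Perm (Fin n)) :
      (List.ofFn fun m => pathWeight w (q (τ m))).prod [] =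
        List.ofFn fun m => (τ m : ℕ) * Fintype.card ι + c := by
    have := list_prod_end_apply (fun m => m * Fintype.card ι + c)
      (List.ofFn fun m => (τ m : ℕ)) (fun m => pathWeight w (q m)) hq
    simpa only [List.map_ofFn, Function.comp_def] using this
  -- Equal products give equal words on the empty list, so `σ` fixes every index.
  have h₁ := congrFun hσ []
  have h₂ := happ 1
  simp only [Equiv.Perm.coe_one, id_eq] at h₂
  rw [happ, h₂] at h₁
  ext m
  have := congrFun (List.ofFn_injective h₁) m
  simpa [hι.ne'] using this

theorem exists_isAnticanonical_traverses (hX : X.IsGorenstein) {k : Type*} [Field k]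
    (distinct : ∀ i j : Fin (r + 1), i ≠ j →
      IsEmpty (X.sheaf k (D i) ≃ₗ[X.coordinateRing k] X.sheaf k (D j)))
    (consistent : IsConsistent X D k) {i j : Vertex X D} (a : i ⟶ j) :
    ∃ (l : Vertex X D) (p : Path l l), IsAnticanonical p ∧ Traverses a p := by
  by_contra! ha
  obtain ⟨e⟩ := consistent
  obtain ⟨x, hx⟩ := exists_standardPoly_superpotentialAlgebra_ne_zero hX distinct a ha
    ((r + 1) * (r + 1) + 1)
  refine hx ?_
  -- Standard identities transfer along any ring isomorphism; `e` need not respect vertices or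
  -- arrows.
  have := map_standardPoly e fun m => e.symm (x m)
  rwa [standardPoly_toricAlgebra_eq_zero k (Nat.lt_succ_self _), map_zero,
    show (fun m => e (e.symm (x m))) = x by simp, eq_comm] at this

end AffineToric

end ToricSuperpotential

end

theorem mainTheorem10 {k : Type*} [Field k] [IsAlgClosed k]
    {M : Type*} [AddCommGroup M] [Module.Free ℤ M] [Module.Finite ℤ M]
    {ι : Type*} [Fintype ι]
    (X : ToricSuperpotential.AffineToric M ι) (hX : X.IsGorenstein)
    {r : ℕ} (D : Fin (r + 1) → ι → ℤ)
    (distinct : ∀ i j : Fin (r + 1), i ≠ j →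
      IsEmpty (X.sheaf k (D i) ≃ₗ[X.coordinateRing k] X.sheaf k (D j)))
    (consistent : ToricSuperpotential.AffineToric.IsConsistent X D k) :
    (∀ (i j : ToricSuperpotential.AffineToric.Vertex X D) (a : i ⟶ j),
      ToricSuperpotential.coxMonomial k (ToricSuperpotential.AffineToric.arrowDiv a) ∣
        ∏ ρ : ι, (MvPolynomial.X ρ : MvPolynomial ι k)) ∧
    (∀ (i j : ToricSuperpotential.AffineToric.Vertex X D) (a : i ⟶ j),
      ∃ (l : ToricSuperpotential.AffineToric.Vertex X D) (p : Quiver.Path l l),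
        ToricSuperpotential.AffineToric.IsAnticanonical p ∧
        ToricSuperpotential.Traverses a p ∧
        ToricSuperpotential.AffineToric.superpotential X D k
          (ToricSuperpotential.CyclicPath.mk p) ≠ 0) := by
  open ToricSuperpotential ToricSuperpotential.AffineToric in
  have key := fun (i j : Vertex X D) (a : i ⟶ j) =>
    exists_isAnticanonical_traverses hX distinct consistent a
  refine ⟨fun i j a => ?_, fun i j a => ?_⟩
  · obtain ⟨l, p, hp, ha⟩ := key i j a
    -- Each exponent is at most `1`, the corresponding coefficient of the label of the cycle.
    refine Finset.prod_dvd_prod_of_dvd _ _ fun ρ _ => ?_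
    have h := ToricSuperpotential.AffineToric.arrowDiv_le_pathDiv ha ρ
    rw [show ToricSuperpotential.AffineToric.pathDiv p = fun _ => 1 from hp] at h
    simpa using pow_dvd_pow (MvPolynomial.X ρ : MvPolynomial ι k) h
  · obtain ⟨l, p, hp, ha⟩ := key i j a
    exact ⟨l, p, hp, ha,
      (ToricSuperpotential.AffineToric.superpotential_mk_ne_zero_iff k p).2 hp⟩
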